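/- Let $\mathcal C$ be a premodular category over $\mathbb C$, i.e. a braided fusion category with a ribbon (equivalently, spherical) structure; write $c$ for its braiding and $\theta$ for its twist, and set $\tilde S_{X,Y}=\operatorname{Tr}(c_{Y,X^*}c_{X^*,Y})$ for objects $X,Y$ of $\mathcal C$, where $\operatorname{Tr}$ is the categorical (quantum) trace; the same notation is used in every premodular category. Let $b\in\mathcal C$ be a boson: an object with $b\otimes b\cong\mathbf 1$, $b\not\cong\mathbf 1$, $c_{b,b}=\mathrm{id}$ and $\theta_b=1$ (equivalently, $b$ is the non-trivial simple object of a ribbon subcategory equivalent to $\operatorname{Rep}(\mathbb Z/2)$ with its standard trivial twist, so $\dim b=1$). Let $A=\mathbf 1+b$ be the corresponding commutative algebra, let $\langle b\rangle'$ be the centralizer of $b$, i.e. the full subcategory of objects $X$ with $c_{b,X}c_{X,b}=\mathrm{id}$, let $\mathcal C_A^0$ be the category of local $A$-modules, that is, the $\mathbb Z/2$-de-equivariantization of $\langle b\rangle'$, with its induced premodular structure, and let $F:\langle b\rangle'\to\mathcal C_A^0$, $X\mapsto A\otimes X$, be the condensation functor. Let $X,Y\in\langle b\rangle'$. (a) If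 $F(X)\cong\alpha$ and $F(Y)\cong\beta$ with $\alpha,\beta$ simple objects of $\mathcal C_A^0$ (so $X$ and $Y$ are of type I: simple with $b\otimes X\not\cong X$, $b\otimes Y\not\cong Y$), then $\tilde S_{\alpha,\beta}=\tilde S_{X,Y}$. (b) If $F(X)\cong\alpha$ is simple and $F(Y)\cong\beta_1\oplus\beta_2$ with $\beta_1,\beta_2$ simple objects of $\mathcal C_A^0$ (this is the case when $X$ is of type I and $Y$ is of type II, i.e. $Y$ is simple with $b\otimes Y\cong Y$), then $\tilde S_{\alpha,\beta_1}+\tilde S_{\alpha,\beta_2}=\tilde S_{X,Y}$. -/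

import Mathlib

open CategoryTheory MonoidalCategory Limits

set_option linter.unusedSectionVars false

universe v u

namespace Condensation

/-! ### Ribbon (premodular) structures, the quantum trace and the `S̃`-matrix -/

section Ribbon

/-- A ribbon structure (a twist) on a rigid braided category: a natural family of automorphisms
`θ_X` with `θ_{X ⊗ Y} = c_{Y,X} c_{X,Y} (θ_X ⊗ θ_Y)` and `θ_{X*} = (θ_X)*`.  On a braided fusion
category this is the same thing as a spherical structure.  Mathlib's "right dual" `Xᘁ` (with
`η_ : 𝟙_ C ⟶ X ⊗ Xᘁ` and `ε_ : Xᘁ ⊗ X ⟶ 𝟙_ C`) is the dual `X*`. -/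
class Ribbon (C : Type u) [Category.{v} C] [MonoidalCategory C] [BraidedCategory C]
    [RightRigidCategory C] where
  twist (X : C) : X ≅ X
  twist_naturality {X Y : C} (f : X ⟶ Y) : f ≫ (twist Y).hom = (twist X).hom ≫ f
  twist_tensor (X Y : C) : (twist (X ⊗ Y)).hom =
    ((twist X).hom ⊗ₘ (twist Y).hom) ≫ (β_ X Y).hom ≫ (β_ Y X).hom
  twist_dual (X : C) : (twist Xᘁ).hom = rightAdjointMate (twist X).hom

/-- The tensor unit has only the scalar endomorphisms: `z ↦ z • id` is a bijection from `ℂ` to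
the endomorphisms of `𝟙_ C`. -/
class HasScalarUnit (C : Type u) [Category.{v} C] [Preadditive C] [Linear ℂ C]
    [MonoidalCategory C] : Prop where
  bijective : Function.Bijective fun z : ℂ => z • 𝟙 (𝟙_ C)

variable {C : Type u} [Category.{v} C] [MonoidalCategory C]

/-- The complex number `z` with `f = z • id`. -/
noncomputable def scalar [Preadditive C] [Linear ℂ C] [HasScalarUnit C]
    (f : 𝟙_ C ⟶ 𝟙_ C) : ℂ :=
  (Equiv.ofBijective _ (HasScalarUnit.bijective (C := C))).symm f

lemma scalar_smul [Preadditive C] [Linear ℂ C] [HasScalarUnit C] (f : 𝟙_ C ⟶ 𝟙_ C) :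
    scalar f • 𝟙 (𝟙_ C) = f :=
  (Equiv.ofBijective _ (HasScalarUnit.bijective (C := C))).apply_symm_apply f

variable [BraidedCategory C] [RightRigidCategory C] [Ribbon C]

/-- The quantum trace of an endomorphism of `X`, as an endomorphism of the unit:
`𝟙 ⟶ X ⊗ X* ⟶ X ⊗ X* ⟶ X* ⊗ X ⟶ 𝟙`, where the maps are the coevaluation, `θ_X f ⊗ id`, the
braiding and the evaluation.  (The pivotal isomorphism `X ≅ X**` is the Drinfeld isomorphism
composed with the twist, and this is the resulting trace.) -/
def qTrace {X : C} (f : X ⟶ X) : 𝟙_ C ⟶ 𝟙_ C :=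
  η_ X Xᘁ ≫ (f ≫ (Ribbon.twist X).hom) ▷ Xᘁ ≫ (β_ X Xᘁ).hom ≫ ε_ X Xᘁ

/-- `S̃_{X,Y} = Tr(c_{Y,X*} c_{X*,Y})`. -/
noncomputable def sTilde [Preadditive C] [Linear ℂ C] [HasScalarUnit C] (X Y : C) : ℂ :=
  scalar (qTrace ((β_ Xᘁ Y).hom ≫ (β_ Y Xᘁ).hom))

end Ribbon

attribute [local instance] Abelian.hasFiniteBiproducts

/-- The conditions which make a `ℂ`-linear abelian rigid monoidal category (with bilinear tensor
product) a fusion category: finite-dimensional morphism spaces, a simple unit, finitely many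
simple objects up to isomorphism, and every object is a finite direct sum of simple objects. -/
class IsFusion (C : Type u) [Category.{v} C] [Abelian C] [Linear ℂ C] [MonoidalCategory C] :
    Prop where
  finite_hom (X Y : C) : FiniteDimensional ℂ (X ⟶ Y)
  simple_unit : Simple (𝟙_ C)
  semisimple : ∃ (n : ℕ) (S : Fin n → C), (∀ i, Simple (S i)) ∧
    ∀ X : C, ∃ (m : ℕ) (f : Fin m → Fin n), Nonempty (X ≅ ⨁ fun j => S (f j))

instance {C : Type u} [Category.{v} C] [Abelian C] [Linear ℂ C] [MonoidalCategory C]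
    [IsFusion C] : HasScalarUnit C where
  bijective := by
    have := IsFusion.simple_unit (C := C)
    have := IsFusion.finite_hom (𝟙_ C) (𝟙_ C)
    constructor
    · intro z w h
      by_contra hne
      apply id_nonzero (𝟙_ C)
      have h' : (z - w) • 𝟙 (𝟙_ C) = 0 := by rw [sub_smul]; exact sub_eq_zero.mpr h
      exact (smul_eq_zero.mp h').resolve_left (sub_ne_zero.mpr hne)
    · intro f
      exact endomorphism_simple_eq_smul_id ℂ f

/-! ### Free modules over a transparent commutative algebra -/

open MonObj

section Free

variable {B : Type u} [Category.{v} B] [MonoidalCategory B] [BraidedCategory B]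

/-- `A` lies in the Müger centre. -/
class Transparent (A : B) : Prop where
  braiding_braiding (X : B) : (β_ A X).hom ≫ (β_ X A).hom = 𝟙 (A ⊗ X)

/-- The twist of `A` is trivial. -/
class TwistTrivial [RightRigidCategory B] [Ribbon B] (A : B) : Prop where
  twist_eq : (Ribbon.twist A).hom = 𝟙 A

/-- The category of free modules `A ⊗ X` over a commutative algebra `A` (its Kleisli category):
the object `gen = X` stands for the module `A ⊗ X`, and a morphism from `X` to `Y`, which is an
`A`-linear map `A ⊗ X ⟶ A ⊗ Y`, is given by its restriction `X ⟶ A ⊗ Y` to the generators; see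
`FreeMod.linearMap` below. -/
structure FreeMod (A : B) : Type u where
  gen : B

namespace FreeMod
variable {A : B}

/-- A morphism of free modules, by its restriction to the generators. -/
@[ext]
structure Hom (X Y : FreeMod A) : Type v where
  val : X.gen ⟶ A ⊗ Y.gen

variable [MonObj A]

lemma one_act (Z : B) :
    (λ_ (A ⊗ Z)).inv ≫ η[A] ▷ (A ⊗ Z) ≫ (α_ A A Z).inv ≫ μ[A] ▷ Z = 𝟙 _ := by
  simp [← comp_whiskerRight]

lemma act_one (Z : B) :
    A ◁ (λ_ Z).inv ≫ A ◁ η[A] ▷ Z ≫ (α_ A A Z).inv ≫ μ[A] ▷ Z = 𝟙 _ := by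
  calc
    _ = 𝟙 _ ⊗≫ (A ◁ η[A] ≫ μ[A]) ▷ Z ⊗≫ 𝟙 _ := by monoidal
    _ = _ := by rw [mul_one]; monoidal

instance : Category (FreeMod A) where
  Hom := Hom
  id X := ⟨(λ_ X.gen).inv ≫ η[A] ▷ X.gen⟩
  comp {X Y Z} f g := ⟨f.val ≫ A ◁ g.val ≫ (α_ A A Z.gen).inv ≫ μ[A] ▷ Z.gen⟩
  id_comp {X Y} f := by
    apply Hom.ext
    dsimp
    rw [Category.assoc, ← whisker_exchange_assoc, ← leftUnitor_inv_naturality_assoc, one_act,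
      Category.comp_id]
  comp_id {X Y} f := by
    apply Hom.ext
    simp [act_one]
  assoc {W X Y Z} f g h := by
    apply Hom.ext
    dsimp
    simp only [Category.assoc, MonoidalCategory.whiskerLeft_comp]
    congr 2
    rw [← whisker_exchange_assoc]
    simp only [tensor_whiskerLeft, Category.assoc, Iso.inv_hom_id_assoc]
    congr 1
    have := congr((α_ A A (A ⊗ Z.gen)).inv ≫ (α_ (A ⊗ A) A Z.gen).inv ≫ $(mul_assoc A) ▷ Z.gen)
    simp only [comp_whiskerRight] at this
    simp at this ⊢
    simp [this]

@[ext] lemma hom_ext {X Y : FreeMod A} {f g : X ⟶ Y} (h : f.val = g.val) : f = g := Hom.ext h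

lemma id_val (X : FreeMod A) : Hom.val (𝟙 X) = (λ_ X.gen).inv ≫ η[A] ▷ X.gen := rfl
lemma comp_val {X Y Z : FreeMod A} (f : X ⟶ Y) (g : Y ⟶ Z) :
    (f ≫ g).val = f.val ≫ A ◁ g.val ≫ (α_ A A Z.gen).inv ≫ μ[A] ▷ Z.gen := rfl

/-- The `A`-linear map `A ⊗ X ⟶ A ⊗ Y` represented by a morphism of `FreeMod A`. -/
def linearMap {X Y : FreeMod A} (f : X ⟶ Y) : A ⊗ X.gen ⟶ A ⊗ Y.gen :=
  A ◁ f.val ≫ (α_ A A Y.gen).inv ≫ μ[A] ▷ Y.gen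

lemma linearMap_id (X : FreeMod A) : linearMap (𝟙 X) = 𝟙 (A ⊗ X.gen) := by
  simp only [linearMap, id_val, MonoidalCategory.whiskerLeft_comp, Category.assoc, act_one]

lemma linearMap_comp {X Y Z : FreeMod A} (f : X ⟶ Y) (g : Y ⟶ Z) :
    linearMap (f ≫ g) = linearMap f ≫ linearMap g := by
  simp only [linearMap, comp_val, Category.assoc, MonoidalCategory.whiskerLeft_comp]
  congr 1
  rw [← whisker_exchange_assoc]
  simp only [tensor_whiskerLeft, Category.assoc, Iso.inv_hom_id_assoc]
  congr 1
  have := congr((α_ A A (A ⊗ Z.gen)).inv ≫ (α_ (A ⊗ A) A Z.gen).inv ≫ $(mul_assoc A) ▷ Z.gen)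
  simp only [comp_whiskerRight] at this
  simp at this ⊢
  simp [this]

/-- `f ↦ linearMap f` is a bijection onto the maps which commute with the actions of `A`. -/
lemma linearMap_bijective (X Y : FreeMod A) (g : A ⊗ X.gen ⟶ A ⊗ Y.gen) :
    (∃! f : X ⟶ Y, linearMap f = g) ↔
      ((α_ A A X.gen).inv ≫ μ[A] ▷ X.gen) ≫ g =
        A ◁ g ≫ (α_ A A Y.gen).inv ≫ μ[A] ▷ Y.gen := by
  have hval (f : X ⟶ Y) : (λ_ X.gen).inv ≫ η[A] ▷ X.gen ≫ linearMap f = f.val := by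
    rw [linearMap, ← whisker_exchange_assoc, ← leftUnitor_inv_naturality_assoc, one_act,
      Category.comp_id]
  constructor
  · rintro ⟨f, rfl, -⟩
    simp only [linearMap, MonoidalCategory.whiskerLeft_comp, Category.assoc]
    rw [← whisker_exchange_assoc]
    simp only [tensor_whiskerLeft, Category.assoc, Iso.inv_hom_id_assoc]
    congr 1
    have := congr((α_ A A (A ⊗ Y.gen)).inv ≫ (α_ (A ⊗ A) A Y.gen).inv ≫ $(mul_assoc A) ▷ Y.gen)
    simp only [comp_whiskerRight] at this
    simp at this ⊢
    simp [this]
  · intro h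
    refine ⟨⟨(λ_ X.gen).inv ≫ η[A] ▷ X.gen ≫ g⟩, ?_, fun f hf => ?_⟩
    · simp only [linearMap, MonoidalCategory.whiskerLeft_comp, Category.assoc]
      rw [← h]
      simpa only [Category.assoc, Category.id_comp] using congr($(act_one (A := A) X.gen) ≫ g)
    · ext
      rw [← hval f, hf]

variable (A) in
/-- The morphism `id ⊗ f` of free modules. -/
def freeMap {X Y : B} (f : X ⟶ Y) : (⟨X⟩ : FreeMod A) ⟶ ⟨Y⟩ := ⟨f ≫ (λ_ Y).inv ≫ η[A] ▷ Y⟩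

lemma freeMap_comp_val {X Y : B} (f : X ⟶ Y) {Z : FreeMod A} (g : (⟨Y⟩ : FreeMod A) ⟶ Z) :
    (freeMap A f ≫ g).val = f ≫ g.val := by
  simp only [comp_val, freeMap, Category.assoc]
  rw [← whisker_exchange_assoc, ← leftUnitor_inv_naturality_assoc, one_act, Category.comp_id]

lemma comp_freeMap_val {Y Z : B} {X : FreeMod A} (g : X ⟶ (⟨Y⟩ : FreeMod A)) (f : Y ⟶ Z) :
    (g ≫ freeMap A f).val = g.val ≫ A ◁ f := by
  simp only [comp_val, freeMap, Category.assoc, MonoidalCategory.whiskerLeft_comp, act_one,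
    Category.comp_id]

variable (A) in
/-- The free module functor `X ↦ A ⊗ X`. -/
def free : B ⥤ FreeMod A where
  obj X := ⟨X⟩
  map f := freeMap A f
  map_id X := by ext; simp [id_val, freeMap]
  map_comp {X Y Z} f g := by ext; rw [freeMap_comp_val]; simp [freeMap]

variable (A) in
/-- The isomorphism `id ⊗ e` of free modules. -/
def freeIso {X Y : B} (e : X ≅ Y) : (⟨X⟩ : FreeMod A) ≅ ⟨Y⟩ := (free A).mapIso e

/-- The tensor product `f ⊗_A id`, where `(A ⊗ X) ⊗_A (A ⊗ Z) = A ⊗ (X ⊗ Z)`. -/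
def wR {X Y : FreeMod A} (f : X ⟶ Y) (Z : FreeMod A) :
   (⟨X.gen ⊗ Z.gen⟩ : FreeMod A) ⟶ ⟨Y.gen ⊗ Z.gen⟩ :=
  ⟨f.val ▷ Z.gen ≫ (α_ A Y.gen Z.gen).hom⟩

/-- The tensor product `id ⊗_A f`, where `(A ⊗ Z) ⊗_A (A ⊗ X) = A ⊗ (Z ⊗ X)`. -/
def wL (Z : FreeMod A) {X Y : FreeMod A} (f : X ⟶ Y) :
   (⟨Z.gen ⊗ X.gen⟩ : FreeMod A) ⟶ ⟨Z.gen ⊗ Y.gen⟩ :=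
  ⟨Z.gen ◁ f.val ≫ (α_ Z.gen A Y.gen).inv ≫ (β_ Z.gen A).hom ▷ Y.gen ≫ (α_ A Z.gen Y.gen).hom⟩

lemma wR_free {X Y : B} (f : X ⟶ Y) (Z : FreeMod A) : wR (freeMap A f) Z = freeMap A (f ▷ Z.gen) := by
  ext; simp [wR, freeMap]

lemma wL_free {X Y : B} (f : X ⟶ Y) (Z : FreeMod A) :
    wL Z (freeMap A f) = freeMap A (Z.gen ◁ f) := by
  ext
  simp only [wL, freeMap, MonoidalCategory.whiskerLeft_comp, Category.assoc]
  congr 1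
  calc
    _ = 𝟙 _ ⊗≫ (Z.gen ◁ η[A] ≫ (β_ Z.gen A).hom) ▷ Y ⊗≫ 𝟙 _ := by monoidal
    _ = _ := by
      rw [BraidedCategory.braiding_naturality_right, braiding_tensorUnit_right]
      monoidal

lemma wR_comp {X Y W : FreeMod A} (f : X ⟶ Y) (g : Y ⟶ W) (Z : FreeMod A) :
    wR (f ≫ g) Z = wR f Z ≫ wR g Z := by
  ext; simp [wR, comp_val]

lemma wL_comp (Z : FreeMod A) {X Y W : FreeMod A} (f : X ⟶ Y) (g : Y ⟶ W) :
    wL Z (f ≫ g) = wL Z f ≫ wL Z g := by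
  ext
  simp only [wL, comp_val, MonoidalCategory.whiskerLeft_comp, Category.assoc]
  congr 1
  calc
    _ = 𝟙 _ ⊗≫ Z.gen ◁ A ◁ g.val ⊗≫ (Z.gen ◁ μ[A] ≫ (β_ Z.gen A).hom) ▷ W.gen ⊗≫ 𝟙 _ := by monoidal
    _ = 𝟙 _ ⊗≫ ((Z.gen ⊗ A) ◁ g.val ≫ (β_ Z.gen A).hom ▷ (A ⊗ W.gen)) ⊗≫ A ◁ (β_ Z.gen A).hom ▷ W.gen ⊗≫
       μ[A] ▷ (Z.gen ⊗ W.gen) := by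
      rw [BraidedCategory.braiding_naturality_right, BraidedCategory.braiding_tensor_right_hom]
      monoidal
    _ = _ := by rw [whisker_exchange]; monoidal

lemma w_exchange [IsCommMonObj A] {W X Y Z : FreeMod A} (f : W ⟶ X) (g : Y ⟶ Z) :
    wL W g ≫ wR f Z = wR f Y ≫ wL X g := by
  ext
  simp only [wL, wR, comp_val, MonoidalCategory.whiskerLeft_comp, Category.assoc]
  calc
    _ = W.gen ◁ g.val ⊗≫ ((β_ W.gen A).hom ≫ A ◁ f.val) ▷ Z.gen ⊗≫ μ[A] ▷ (X.gen ⊗ Z.gen) := by monoidal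
    _ = (W.gen ◁ g.val ≫ f.val ▷ (A ⊗ Z.gen)) ⊗≫ A ◁ (β_ X.gen A).hom ▷ Z.gen ⊗≫
       ((β_ A A).hom ≫ μ[A]) ▷ (X.gen ⊗ Z.gen) := by
      rw [← BraidedCategory.braiding_naturality_left, BraidedCategory.braiding_tensor_left_hom]
      monoidal
    _ = _ := by
      rw [IsCommMonObj.mul_comm, whisker_exchange]; monoidal

variable [IsCommMonObj A]

/-- The tensor product over `A`: `(A ⊗ X) ⊗_A (A ⊗ Y) = A ⊗ (X ⊗ Y)`. -/
instance : MonoidalCategoryStruct (FreeMod A) where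
  tensorObj X Y := ⟨X.gen ⊗ Y.gen⟩
  whiskerLeft Z _ _ f := wL Z f
  whiskerRight f Z := wR f Z
  tensorHom {_ Y₁ X₂ _} f g := wR f X₂ ≫ wL Y₁ g
  tensorUnit := ⟨𝟙_ B⟩
  associator X Y Z := freeIso A (α_ X.gen Y.gen Z.gen)
  leftUnitor X := freeIso A (λ_ X.gen)
  rightUnitor X := freeIso A (ρ_ X.gen)

lemma freeIso_hom {X Y : B} (e : X ≅ Y) : (freeIso A e).hom = freeMap A e.hom := rfl
lemma freeIso_inv {X Y : B} (e : X ≅ Y) : (freeIso A e).inv = freeMap A e.inv := rfl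
lemma freeMap_comp {X Y Z : B} (f : X ⟶ Y) (g : Y ⟶ Z) : freeMap A (f ≫ g) = freeMap A f ≫ freeMap A g :=
  (free A).map_comp f g
lemma freeMap_id (X : B) : freeMap A (𝟙 X) = 𝟙 (⟨X⟩ : FreeMod A) :=
  (free A).map_id X

lemma nat1 {X X' : FreeMod A} (f : X ⟶ X') (Y Z : FreeMod A) :
    wR (wR f Y) Z ≫ freeMap A (α_ X'.gen Y.gen Z.gen).hom =
      freeMap A (α_ X.gen Y.gen Z.gen).hom ≫ wR f ⟨Y.gen ⊗ Z.gen⟩ := by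
  ext
  rw [freeMap_comp_val, comp_freeMap_val]
  simp [wR]

lemma nat2 {X X' : FreeMod A} (f : X ⟶ X') (Y Z : FreeMod A) :
    wR (wL Y f) Z ≫ freeMap A (α_ Y.gen X'.gen Z.gen).hom =
      freeMap A (α_ Y.gen X.gen Z.gen).hom ≫ wL Y (wR f Z) := by
  ext
  rw [freeMap_comp_val, comp_freeMap_val]
  simp [wR, wL]

lemma nat3 {X X' : FreeMod A} (f : X ⟶ X') (Y Z : FreeMod A) :
    wL ⟨Y.gen ⊗ Z.gen⟩ f ≫ freeMap A (α_ Y.gen Z.gen X'.gen).hom =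
      freeMap A (α_ Y.gen Z.gen X.gen).hom ≫ wL Y (wL Z f) := by
  ext
  rw [freeMap_comp_val, comp_freeMap_val]
  simp [wL]

lemma wR_id (X Y : FreeMod A) : wR (𝟙 X) Y = 𝟙 (⟨X.gen ⊗ Y.gen⟩ : FreeMod A) := by
  rw [← freeMap_id, ← freeMap_id, wR_free, id_whiskerRight]

lemma wL_id (X Y : FreeMod A) : wL X (𝟙 Y) = 𝟙 (⟨X.gen ⊗ Y.gen⟩ : FreeMod A) := by
  rw [← freeMap_id, ← freeMap_id, wL_free, whiskerLeft_id]

instance : MonoidalCategory (FreeMod A) where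
  tensorHom_def _ _ := rfl
  id_tensorHom_id X Y := by
    change wR _ _ ≫ wL _ _ = _
    rw [wR_id, wL_id, Category.comp_id]
    rfl
  tensorHom_comp_tensorHom f₁ f₂ g₁ g₂ := by
    change (wR f₁ _ ≫ wL _ f₂) ≫ (wR g₁ _ ≫ wL _ g₂) = wR (f₁ ≫ g₁) _ ≫ wL _ (f₂ ≫ g₂)
    simp only [wR_comp, wL_comp, Category.assoc]
    slice_lhs 2 3 => rw [w_exchange]
    simp only [Category.assoc]
  whiskerLeft_id X Y := wL_id X Y
  id_whiskerRight X Y := wR_id X Y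
  associator_naturality {X₁ X₂ X₃ Y₁ Y₂ Y₃} f g h := by
    change (wR (wR f X₂ ≫ wL Y₁ g) X₃ ≫ wL ⟨Y₁.gen ⊗ Y₂.gen⟩ h) ≫ freeMap A (α_ _ _ _).hom =
      freeMap A (α_ _ _ _).hom ≫ (wR f ⟨X₂.gen ⊗ X₃.gen⟩ ≫ wL Y₁ (wR g X₃ ≫ wL Y₂ h))
    rw [wR_comp, wL_comp, Category.assoc, Category.assoc, nat3]
    slice_lhs 2 3 => rw [nat2]
    slice_lhs 1 2 => rw [nat1]
    simp only [Category.assoc]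
  leftUnitor_naturality {X Y} f := by
    change wL ⟨𝟙_ B⟩ f ≫ freeMap A (λ_ _).hom = freeMap A (λ_ _).hom ≫ f
    ext
    rw [freeMap_comp_val, comp_freeMap_val]
    simp [wL, braiding_tensorUnit_left]
  rightUnitor_naturality {X Y} f := by
    change wR f ⟨𝟙_ B⟩ ≫ freeMap A (ρ_ _).hom = freeMap A (ρ_ _).hom ≫ f
    ext
    rw [freeMap_comp_val, comp_freeMap_val]
    simp [wR]
  pentagon W X Y Z := by
    change wR (freeMap A (α_ _ _ _).hom) _ ≫ freeMap A (α_ _ _ _).hom ≫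
      wL _ (freeMap A (α_ _ _ _).hom) = freeMap A (α_ _ _ _).hom ≫ freeMap A (α_ _ _ _).hom
    simp only [wR_free, wL_free, ← freeMap_comp]
    rw [MonoidalCategory.pentagon]
  triangle X Y := by
    change freeMap A (α_ _ _ _).hom ≫ wL _ (freeMap A (λ_ _).hom) = wR (freeMap A (ρ_ _).hom) _
    simp only [wR_free, wL_free, ← freeMap_comp]
    rw [MonoidalCategory.triangle]

/-- The braiding of free modules is induced by the braiding of the generators. -/
instance [Transparent A] : BraidedCategory (FreeMod A) where
  braiding X Y := freeIso A (β_ X.gen Y.gen)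
  braiding_naturality_right X Y Z f := by
    change wL X f ≫ freeMap A (β_ _ _).hom = freeMap A (β_ _ _).hom ≫ wR f X
    ext
    rw [freeMap_comp_val, comp_freeMap_val]
    simp only [wL, wR]
    rw [← BraidedCategory.braiding_naturality_right_assoc, BraidedCategory.braiding_tensor_right_hom]
    simp
  braiding_naturality_left {X Y} f Z := by
    change wR f Z ≫ freeMap A (β_ _ _).hom = freeMap A (β_ _ _).hom ≫ wL Z f
    ext
    rw [freeMap_comp_val, comp_freeMap_val]
    simp only [wL, wR]
    rw [← BraidedCategory.braiding_naturality_left_assoc, BraidedCategory.braiding_tensor_left_hom]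
    have := congr($(Transparent.braiding_braiding (A := A) Z.gen) ▷ Y.gen)
    simp only [comp_whiskerRight, id_whiskerRight] at this
    simp only [Category.assoc, Iso.hom_inv_id_assoc]
    slice_rhs 5 6 => rw [this]
    simp
  hexagon_forward X Y Z := by
    change freeMap A (α_ _ _ _).hom ≫ freeMap A (β_ _ _).hom ≫ freeMap A (α_ _ _ _).hom =
      wR (freeMap A (β_ _ _).hom) _ ≫ freeMap A (α_ _ _ _).hom ≫ wL _ (freeMap A (β_ _ _).hom)
    simp only [wR_free, wL_free, ← freeMap_comp]
    congr 1
    exact BraidedCategory.hexagon_forward X.gen Y.gen Z.gen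
  hexagon_reverse X Y Z := by
    change freeMap A (α_ _ _ _).inv ≫ freeMap A (β_ _ _).hom ≫ freeMap A (α_ _ _ _).inv =
      wL _ (freeMap A (β_ _ _).hom) ≫ freeMap A (α_ _ _ _).inv ≫ wR (freeMap A (β_ _ _).hom) _
    simp only [wR_free, wL_free, ← freeMap_comp]
    congr 1
    exact BraidedCategory.hexagon_reverse X.gen Y.gen Z.gen

variable [RightRigidCategory B]

/-- The dual of `A ⊗ X` is `A ⊗ X*`. -/
instance (X : FreeMod A) : HasRightDual X where
  rightDual := ⟨X.genᘁ⟩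
  exact :=
    { coevaluation' := freeMap A (η_ X.gen X.genᘁ)
      evaluation' := freeMap A (ε_ X.gen X.genᘁ)
      coevaluation_evaluation' := by
        change wL _ (freeMap A _) ≫ freeMap A (α_ _ _ _).inv ≫ wR (freeMap A _) _ =
          freeMap A (ρ_ _).hom ≫ freeMap A (λ_ _).inv
        simp only [wR_free, wL_free, ← freeMap_comp]
        congr 1
        exact ExactPairing.coevaluation_evaluation _ _
      evaluation_coevaluation' := by
        change wR (freeMap A _) _ ≫ freeMap A (α_ _ _ _).hom ≫ wL _ (freeMap A _) =
          freeMap A (λ_ _).hom ≫ freeMap A (ρ_ _).inv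
        simp only [wR_free, wL_free, ← freeMap_comp]
        congr 1
        exact ExactPairing.evaluation_coevaluation _ _ }

instance : RightRigidCategory (FreeMod A) where

lemma mate_freeMap {X Y : FreeMod A} (f : X.gen ⟶ Y.gen) :
    rightAdjointMate (X := X) (Y := Y) (freeMap A f) = freeMap A (rightAdjointMate f) := by
  change freeMap A (ρ_ _).inv ≫ wL _ (freeMap A _) ≫ wL _ (wR (freeMap A _) _) ≫
    freeMap A (α_ _ _ _).inv ≫ wR (freeMap A _) _ ≫ freeMap A (λ_ _).hom = _
  simp only [wR_free, wL_free, ← freeMap_comp]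
  rfl

/-- The twist of `A ⊗ X` is `id ⊗ θ_X` (which is `θ_{A ⊗ X}`). -/
instance [Transparent A] [Ribbon B] [TwistTrivial A] : Ribbon (FreeMod A) where
  twist X := freeIso A (Ribbon.twist X.gen)
  twist_naturality {X Y} f := by
    change f ≫ freeMap A _ = freeMap A _ ≫ f
    ext
    rw [freeMap_comp_val, comp_freeMap_val]
    have h2 := Ribbon.twist_tensor A Y.gen
    rw [Transparent.braiding_braiding, TwistTrivial.twist_eq (A := A), id_tensorHom, Category.comp_id] at h2
    rw [← h2, Ribbon.twist_naturality]
  twist_tensor X Y := by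
    change freeMap A _ = (wR (freeMap A _) _ ≫ wL _ (freeMap A _)) ≫ freeMap A (β_ _ _).hom ≫ freeMap A (β_ _ _).hom
    simp only [wR_free, wL_free, ← freeMap_comp]
    congr 1
    rw [← MonoidalCategory.tensorHom_def]
    exact Ribbon.twist_tensor _ _
  twist_dual X := by
    change freeMap A _ = rightAdjointMate (X := X) (Y := X) (freeMap A _)
    rw [mate_freeMap, ← Ribbon.twist_dual]
    rfl

section Pre
variable (X Y : FreeMod A)
/-- Morphisms and their restrictions to the generators. -/
def homEquiv : (X ⟶ Y) ≃ (X.gen ⟶ A ⊗ Y.gen) where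
  toFun f := f.val
  invFun f := ⟨f⟩

instance [Preadditive B] : AddCommGroup (X ⟶ Y) := (homEquiv X Y).addCommGroup

instance [Preadditive B] [MonoidalPreadditive B] : Preadditive (FreeMod A) where
  add_comp X Y Z f g h := by
    ext
    change (f.val + g.val) ≫ _ = f.val ≫ _ + g.val ≫ _
    simp
  comp_add X Y Z f g h := by
    ext
    change f.val ≫ _ ◁ (g.val + h.val) ≫ _ = f.val ≫ _ + f.val ≫ _
    simp

variable [Preadditive B] [MonoidalPreadditive B] [Linear ℂ B]
instance : Module ℂ (X ⟶ Y) := (homEquiv X Y).module ℂ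

instance [MonoidalLinear ℂ B] : Linear ℂ (FreeMod A) where
  smul_comp X Y Z r f g := by
    ext
    change (r • f.val) ≫ _ = r • (f.val ≫ _)
    simp
  comp_smul X Y Z f r g := by
    ext
    change f.val ≫ _ ◁ (r • g.val) ≫ _ = r • (f.val ≫ _)
    simp

end Pre

section Pre
variable [Preadditive B] [MonoidalPreadditive B]

instance : (free A).Additive where
  map_add {X Y f g} := by
    ext
    change (f + g) ≫ _ = f ≫ _ + g ≫ _
    rw [Preadditive.add_comp]
    rfl

instance [HasFiniteBiproducts B] : HasFiniteBiproducts (FreeMod A) where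
  out _ :=
    { has_biproduct := fun f =>
        inferInstanceAs (HasBiproduct fun i => (free A).obj (f i).gen) }

end Pre
end FreeMod
end Free
/-! ### The ribbon structure of an idempotent completion -/

section Envelope

open Idempotents
variable {D : Type u} [Category.{v} D]

/-- The morphism of formal direct summands `(X, p) ⟶ (Y, q)` induced by a morphism `g : X ⟶ Y`
which commutes with the idempotents. -/
def summandMap {P Q : Karoubi D} (g : P.X ⟶ Q.X) (h : P.p ≫ g = g ≫ Q.p) : P ⟶ Q :=
  ⟨P.p ≫ g, by rw [Category.assoc, ← h, P.idem_assoc, P.idem_assoc]⟩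

lemma summandMap_f {P Q : Karoubi D} (g : P.X ⟶ Q.X) (h : P.p ≫ g = g ≫ Q.p) :
    (summandMap g h).f = P.p ≫ g := rfl

lemma summandMap_comp {P Q R : Karoubi D} (g : P.X ⟶ Q.X) (h : P.p ≫ g = g ≫ Q.p)
    (g' : Q.X ⟶ R.X) (h' : Q.p ≫ g' = g' ≫ R.p) :
    summandMap g h ≫ summandMap g' h' =
      summandMap (g ≫ g') (by rw [← Category.assoc, h, Category.assoc, h', Category.assoc]) := by
  ext
  rw [Karoubi.comp_f, summandMap_f, summandMap_f, summandMap_f, Category.assoc, ← Category.assoc g,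
    ← h, Category.assoc, P.idem_assoc]

lemma summandMap_comp_f {P Q R : Karoubi D} (g : P.X ⟶ Q.X) (h : P.p ≫ g = g ≫ Q.p)
    (f : Q ⟶ R) : (summandMap g h ≫ f).f = g ≫ f.f := by
  rw [Karoubi.comp_f, summandMap_f, h, Category.assoc, Karoubi.p_comp]

lemma comp_summandMap_f {P Q R : Karoubi D} (g : Q.X ⟶ R.X) (h : Q.p ≫ g = g ≫ R.p)
    (f : P ⟶ Q) : (f ≫ summandMap g h).f = f.f ≫ g := by
  rw [Karoubi.comp_f, summandMap_f, Karoubi.comp_p_assoc]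

lemma iso_comm {P Q : Karoubi D} (e : P.X ≅ Q.X) (h : P.p ≫ e.hom = e.hom ≫ Q.p) :
    Q.p ≫ e.inv = e.inv ≫ P.p := by
  rw [← cancel_mono e.hom, ← cancel_epi e.hom]; simp [h]

/-- The isomorphism of formal direct summands induced by an isomorphism which commutes with the
idempotents. -/
def summandIso {P Q : Karoubi D} (e : P.X ≅ Q.X) (h : P.p ≫ e.hom = e.hom ≫ Q.p) : P ≅ Q where
  hom := summandMap e.hom h
  inv := summandMap e.inv (iso_comm e h)
  hom_inv_id := by ext; rw [comp_summandMap_f, summandMap_f]; simp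
  inv_hom_id := by ext; rw [comp_summandMap_f, summandMap_f]; simp

variable [MonoidalCategory D]

/-- The tensor product `(X, p) ⊗ (Y, q) = (X ⊗ Y, p ⊗ q)`. -/
instance : MonoidalCategoryStruct (Karoubi D) where
  tensorObj P Q := ⟨P.X ⊗ Q.X, P.p ⊗ₘ Q.p, by simp⟩
  whiskerLeft P _ _ f := ⟨P.p ⊗ₘ f.f, by simp⟩
  whiskerRight f P := ⟨f.f ⊗ₘ P.p, by simp⟩
  tensorHom f g := ⟨f.f ⊗ₘ g.f, by simp⟩
  tensorUnit := ⟨𝟙_ D, 𝟙 _, by simp⟩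
  associator P Q R := summandIso (α_ P.X Q.X R.X) (by simp)
  leftUnitor P := summandIso (λ_ P.X) (by simp)
  rightUnitor P := summandIso (ρ_ P.X) (by simp)

variable {P Q R S : Karoubi D}

lemma summand_whiskerLeft (f : Q ⟶ R) : (P ◁ f).f = (P.p ⊗ₘ f.f) := rfl
lemma summand_whiskerRight (f : Q ⟶ R) : (f ▷ P).f = (f.f ⊗ₘ P.p) := rfl
lemma summand_tensorHom (f : P ⟶ Q) (g : R ⟶ S) : (f ⊗ₘ g).f = (f.f ⊗ₘ g.f) := rfl

lemma whiskerLeft_summandMap (g : Q.X ⟶ R.X) (h : Q.p ≫ g = g ≫ R.p) :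
    P ◁ summandMap g h = summandMap (P := P ⊗ Q) (Q := P ⊗ R) (P.X ◁ g)
      (by change (P.p ⊗ₘ Q.p) ≫ _ = _ ≫ (P.p ⊗ₘ R.p)
          rw [← id_tensorHom, tensorHom_comp_tensorHom, tensorHom_comp_tensorHom, h]; simp) := by
  ext
  rw [summand_whiskerLeft, summandMap_f, summandMap_f]
  change _ = (P.p ⊗ₘ Q.p) ≫ _
  rw [← id_tensorHom, tensorHom_comp_tensorHom, Category.comp_id]

lemma summandMap_whiskerRight (g : Q.X ⟶ R.X) (h : Q.p ≫ g = g ≫ R.p) :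
    summandMap g h ▷ P = summandMap (P := Q ⊗ P) (Q := R ⊗ P) (g ▷ P.X)
      (by change (Q.p ⊗ₘ P.p) ≫ _ = _ ≫ (R.p ⊗ₘ P.p)
          rw [← tensorHom_id, tensorHom_comp_tensorHom, tensorHom_comp_tensorHom, h]; simp) := by
  ext
  rw [summand_whiskerRight, summandMap_f, summandMap_f]
  change _ = (Q.p ⊗ₘ P.p) ≫ _
  rw [← tensorHom_id, tensorHom_comp_tensorHom, Category.comp_id]

lemma comp_summandIso_f (e : Q.X ≅ R.X) (h : Q.p ≫ e.hom = e.hom ≫ R.p) (f : P ⟶ Q) :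
    (f ≫ (summandIso e h).hom).f = f.f ≫ e.hom := comp_summandMap_f _ h _

lemma summandIso_comp_f (e : P.X ≅ Q.X) (h : P.p ≫ e.hom = e.hom ≫ Q.p) (f : Q ⟶ R) :
    ((summandIso e h).hom ≫ f).f = e.hom ≫ f.f := summandMap_comp_f _ h _

lemma summandIso_hom (e : P.X ≅ Q.X) (h : P.p ≫ e.hom = e.hom ≫ Q.p) :
    (summandIso e h).hom = summandMap e.hom h := rfl

lemma summandIso_inv (e : P.X ≅ Q.X) (h : P.p ≫ e.hom = e.hom ≫ Q.p) :
    (summandIso e h).inv = summandMap e.inv (iso_comm e h) := rfl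

lemma summand_associator (P Q R : Karoubi D) : α_ P Q R = summandIso
    (P := (P ⊗ Q) ⊗ R) (Q := P ⊗ (Q ⊗ R)) (α_ P.X Q.X R.X) (associator_naturality _ _ _) := rfl

lemma summand_leftUnitor (P : Karoubi D) : λ_ P = summandIso (P := 𝟙_ (Karoubi D) ⊗ P)
    (λ_ P.X) (by change (𝟙 (𝟙_ D) ⊗ₘ P.p) ≫ _ = _; simp) := rfl

lemma summand_rightUnitor (P : Karoubi D) : ρ_ P = summandIso (P := P ⊗ 𝟙_ (Karoubi D))
    (ρ_ P.X) (by change (P.p ⊗ₘ 𝟙 (𝟙_ D)) ≫ _ = _; simp) := rfl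

instance : MonoidalCategory (Karoubi D) where
  tensorHom_def f g := by
    ext; simp [summand_whiskerLeft, summand_whiskerRight, summand_tensorHom]
  id_tensorHom_id _ _ := rfl
  tensorHom_comp_tensorHom _ _ _ _ := by ext; simp [summand_tensorHom]
  whiskerLeft_id _ _ := rfl
  id_whiskerRight _ _ := rfl
  associator_naturality {P₁ P₂ P₃ Q₁ Q₂ Q₃} f g h := by
    ext
    rw [summand_associator, summand_associator, comp_summandIso_f, summandIso_comp_f]
    exact associator_naturality f.f g.f h.f
  leftUnitor_naturality {P Q} f := by
    ext
    rw [summand_leftUnitor, summand_leftUnitor, comp_summandIso_f, summandIso_comp_f]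
    change (𝟙 (𝟙_ D) ⊗ₘ f.f) ≫ _ = _
    simp
  rightUnitor_naturality {P Q} f := by
    ext
    rw [summand_rightUnitor, summand_rightUnitor, comp_summandIso_f, summandIso_comp_f]
    change (f.f ⊗ₘ 𝟙 (𝟙_ D)) ≫ _ = _
    simp
  pentagon P Q R S := by
    simp only [summand_associator, summandIso_hom, whiskerLeft_summandMap, summandMap_whiskerRight,
      summandMap_comp]
    congr 1
    exact MonoidalCategory.pentagon _ _ _ _
  triangle P Q := by
    simp only [summand_associator, summand_leftUnitor, summand_rightUnitor, summandIso_hom,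
      whiskerLeft_summandMap, summandMap_whiskerRight, summandMap_comp]
    congr 1
    exact MonoidalCategory.triangle _ _

instance [BraidedCategory D] : BraidedCategory (Karoubi D) where
  braiding P Q := summandIso (P := P ⊗ Q) (Q := Q ⊗ P) (β_ P.X Q.X)
    (BraidedCategory.braiding_naturality _ _)
  braiding_naturality_right P _ _ f := by
    ext
    rw [comp_summandIso_f, summandIso_comp_f]
    exact BraidedCategory.braiding_naturality _ _
  braiding_naturality_left f P := by
    ext
    rw [comp_summandIso_f, summandIso_comp_f]
    exact BraidedCategory.braiding_naturality _ _
  hexagon_forward P Q R := by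
    simp only [summand_associator, summandIso_hom, whiskerLeft_summandMap, summandMap_whiskerRight,
      summandMap_comp]
    congr 1
    exact BraidedCategory.hexagon_forward _ _ _
  hexagon_reverse P Q R := by
    simp only [summand_associator, summandIso_hom, summandIso_inv, whiskerLeft_summandMap,
      summandMap_whiskerRight, summandMap_comp]
    congr 1
    exact BraidedCategory.hexagon_reverse _ _ _

lemma summand_braiding [BraidedCategory D] (P Q : Karoubi D) :
    β_ P Q = summandIso (P := P ⊗ Q) (Q := Q ⊗ P) (β_ P.X Q.X)
      (BraidedCategory.braiding_naturality _ _) := rfl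

variable [RightRigidCategory D]

lemma coev_absorb (X : D) (p : X ⟶ X) (h : p ≫ p = p) :
    η_ X Xᘁ ≫ (p ⊗ₘ rightAdjointMate p) = η_ X Xᘁ ≫ p ▷ _ := by
  rw [tensorHom_def', coevaluation_comp_rightAdjointMate_assoc, ← comp_whiskerRight, h]

lemma absorb_ev (X : D) (p : X ⟶ X) (h : p ≫ p = p) :
    (rightAdjointMate p ⊗ₘ p) ≫ ε_ X Xᘁ = _ ◁ p ≫ ε_ X Xᘁ := by
  rw [tensorHom_def', Category.assoc, rightAdjointMate_comp_evaluation,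
    ← MonoidalCategory.whiskerLeft_comp_assoc, h]

lemma zigzag₁ (X : D) (p : X ⟶ X) (h : p ≫ p = p) :
    (rightAdjointMate p ⊗ₘ (η_ X Xᘁ ≫ p ▷ _)) ≫
      ((rightAdjointMate p ⊗ₘ (p ⊗ₘ rightAdjointMate p)) ≫ (α_ _ _ _).inv) ≫
        ((_ ◁ p ≫ ε_ X Xᘁ) ⊗ₘ rightAdjointMate p) =
      (ρ_ _).hom ≫ rightAdjointMate p ≫ (λ_ _).inv := by
  have hq : rightAdjointMate p ≫ rightAdjointMate p = rightAdjointMate p := by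
    rw [← comp_rightAdjointMate, h]
  generalize hq' : rightAdjointMate p = q at *
  have hc : η_ X Xᘁ ≫ (p ⊗ₘ q) = η_ X Xᘁ ≫ p ▷ _ := by rw [← hq', coev_absorb _ _ h]
  have hc' : η_ X Xᘁ ≫ (p ⊗ₘ q) = η_ X Xᘁ ≫ X ◁ q := by
    rw [hc, ← hq', coevaluation_comp_rightAdjointMate]
  rw [← hc, ← Category.assoc, ← Category.assoc, tensorHom_comp_tensorHom, hq, Category.assoc, Category.assoc (η_ X Xᘁ),
    tensorHom_comp_tensorHom, h, hq, hc', MonoidalCategory.tensorHom_def' (_ ◁ p ≫ _),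
    MonoidalCategory.tensorHom_def q, comp_whiskerRight, Category.assoc]
  calc
    _ = q ▷ _ ⊗≫ Xᘁ ◁ (η_ X Xᘁ ≫ X ◁ (q ≫ q) ≫ p ▷ _) ⊗≫ ε_ X Xᘁ ▷ Xᘁ := by monoidal
    _ = q ▷ _ ⊗≫ Xᘁ ◁ (η_ X Xᘁ ≫ X ◁ q) ⊗≫ ε_ X Xᘁ ▷ Xᘁ := by
      rw [hq, ← MonoidalCategory.tensorHom_def', hc']
    _ = q ▷ _ ⊗≫ Xᘁ ◁ η_ X Xᘁ ⊗≫ ((Xᘁ ⊗ X) ◁ q ≫ ε_ X Xᘁ ▷ Xᘁ) := by monoidal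
    _ = q ▷ _ ⊗≫ (Xᘁ ◁ η_ X Xᘁ ≫ (α_ _ _ _).inv ≫ ε_ X Xᘁ ▷ Xᘁ) ≫ _ ◁ q := by
      rw [whisker_exchange]; monoidal
    _ = (ρ_ _).hom ≫ (q ≫ q) ≫ (λ_ _).inv := by
      rw [ExactPairing.coevaluation_evaluation]; monoidal
    _ = _ := by rw [hq]

lemma zigzag₂ (X : D) (p : X ⟶ X) (h : p ≫ p = p) :
    ((η_ X Xᘁ ≫ p ▷ _) ⊗ₘ p) ≫
      (((p ⊗ₘ rightAdjointMate p) ⊗ₘ p) ≫ (α_ _ _ _).hom) ≫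
        (p ⊗ₘ (_ ◁ p ≫ ε_ X Xᘁ)) =
      (λ_ _).hom ≫ p ≫ (ρ_ _).inv := by
  generalize hq' : rightAdjointMate p = q at *
  have hc : η_ X Xᘁ ≫ (p ⊗ₘ q) = η_ X Xᘁ ≫ p ▷ _ := by rw [← hq', coev_absorb _ _ h]
  have hq : q ≫ q = q := by rw [← hq', ← comp_rightAdjointMate, h]
  rw [← hc, ← Category.assoc, ← Category.assoc, tensorHom_comp_tensorHom, h, Category.assoc, Category.assoc (η_ X Xᘁ),
    tensorHom_comp_tensorHom, h, hq, hc, MonoidalCategory.tensorHom_def p,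
    MonoidalCategory.tensorHom_def' _ p, MonoidalCategory.whiskerLeft_comp, Category.assoc]
  calc
    _ = 𝟙_ D ◁ p ⊗≫ ((η_ X Xᘁ ≫ (p ≫ p) ▷ Xᘁ) ▷ X ≫ (X ⊗ Xᘁ) ◁ p) ⊗≫ X ◁ ε_ X Xᘁ := by monoidal
    _ = 𝟙_ D ◁ (p ≫ p) ⊗≫ η_ X Xᘁ ▷ X ⊗≫ ((p ≫ p) ▷ (Xᘁ ⊗ X) ≫ X ◁ ε_ X Xᘁ) := by
      rw [← whisker_exchange]; monoidal
    _ = 𝟙_ D ◁ p ⊗≫ (η_ X Xᘁ ▷ X ≫ (α_ _ _ _).hom ≫ X ◁ ε_ X Xᘁ) ≫ p ▷ 𝟙_ D := by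
      rw [h, ← whisker_exchange]; monoidal
    _ = (λ_ _).hom ≫ (p ≫ p) ≫ (ρ_ _).inv := by
      rw [ExactPairing.evaluation_coevaluation]; monoidal
    _ = _ := by rw [h]

lemma mate_unique {X Y : D} (f : X ⟶ Y) (g : Yᘁ ⟶ Xᘁ)
    (h : g ▷ X ≫ ε_ X Xᘁ = Yᘁ ◁ f ≫ ε_ Y Yᘁ) : rightAdjointMate f = g := by
  rw [← rightAdjointMate_comp_evaluation] at h
  have := congr(tensorRightHomEquiv _ X Xᘁ _ $h)
  simpa using this.symm

/-- The dual `(X, p)* = (X*, p*)`. -/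
instance (P : Karoubi D) : HasRightDual P where
  rightDual := ⟨P.Xᘁ, rightAdjointMate P.p, by rw [← comp_rightAdjointMate, P.idem]⟩
  exact :=
    { coevaluation' := ⟨η_ P.X P.Xᘁ ≫ P.p ▷ _, by
        change 𝟙 _ ≫ (η_ P.X P.Xᘁ ≫ P.p ▷ _) ≫ (P.p ⊗ₘ rightAdjointMate P.p) = _
        rw [← coev_absorb _ _ P.idem]; simp [← comp_rightAdjointMate]⟩
      evaluation' := ⟨P.Xᘁ ◁ P.p ≫ ε_ P.X P.Xᘁ, by
        change (rightAdjointMate P.p ⊗ₘ P.p) ≫ (P.Xᘁ ◁ P.p ≫ ε_ P.X P.Xᘁ) ≫ 𝟙 _ = _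
        rw [← absorb_ev _ _ P.idem]; simp [← comp_rightAdjointMate]⟩
      coevaluation_evaluation' := by
        rw [summand_leftUnitor, summand_rightUnitor, summand_associator]
        ext
        rw [summandIso_comp_f]
        exact zigzag₁ _ _ P.idem
      evaluation_coevaluation' := by
        rw [summand_leftUnitor, summand_rightUnitor, summand_associator]
        ext
        rw [summandIso_comp_f]
        exact zigzag₂ _ _ P.idem }

instance : RightRigidCategory (Karoubi D) where

lemma mate_f (f : P ⟶ Q) : (rightAdjointMate f).f = rightAdjointMate f.f := by
  have hc : rightAdjointMate Q.p ≫ rightAdjointMate f.f ≫ rightAdjointMate P.p =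
      rightAdjointMate f.f := by
    rw [← comp_rightAdjointMate, ← comp_rightAdjointMate, Category.assoc, f.comm]
  let g : Qᘁ ⟶ Pᘁ := ⟨rightAdjointMate f.f, hc⟩
  suffices h : rightAdjointMate f = g by rw [h]
  apply mate_unique
  ext
  change (rightAdjointMate f.f ⊗ₘ P.p) ≫ (P.Xᘁ ◁ P.p ≫ ε_ P.X P.Xᘁ) =
    (rightAdjointMate Q.p ⊗ₘ f.f) ≫ (Q.Xᘁ ◁ Q.p ≫ ε_ Q.X Q.Xᘁ)
  simp only [tensorHom_def', Category.assoc]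
  rw [← whisker_exchange_assoc, ← whisker_exchange_assoc, rightAdjointMate_comp_evaluation,
    rightAdjointMate_comp_evaluation]
  simp only [← MonoidalCategory.whiskerLeft_comp_assoc]
  simp

instance [BraidedCategory D] [Ribbon D] : Ribbon (Karoubi D) where
  twist P := summandIso (Ribbon.twist P.X) (Ribbon.twist_naturality _)
  twist_naturality f := by
    ext
    rw [comp_summandIso_f, summandIso_comp_f]
    exact Ribbon.twist_naturality _
  twist_tensor P Q := by
    rw [summand_braiding, summand_braiding]
    ext
    rw [← Category.assoc, comp_summandIso_f, comp_summandIso_f, summand_tensorHom]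
    change (P.p ⊗ₘ Q.p) ≫ (Ribbon.twist (P.X ⊗ Q.X)).hom =
      ((P.p ≫ (Ribbon.twist _).hom ⊗ₘ Q.p ≫ (Ribbon.twist _).hom) ≫ _) ≫ _
    rw [Ribbon.twist_tensor]
    simp
  twist_dual P := by
    ext
    rw [mate_f]
    change rightAdjointMate P.p ≫ (Ribbon.twist P.Xᘁ).hom =
      rightAdjointMate (P.p ≫ (Ribbon.twist P.X).hom)
    rw [Ribbon.twist_naturality, comp_rightAdjointMate, Ribbon.twist_dual]

section Lin
variable [Preadditive D] [Linear ℂ D]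
instance (P Q : Karoubi D) : SMul ℂ (P ⟶ Q) where
  smul r f := ⟨r • f.f, by simp⟩

lemma summand_smul_f (r : ℂ) (f : P ⟶ Q) : (r • f).f = r • f.f := rfl

instance (P Q : Karoubi D) : Module ℂ (P ⟶ Q) :=
  Function.Injective.module ℂ (Karoubi.inclusionHom P Q) (fun _ _ h => Karoubi.hom_ext _ _ h)
    (fun _ _ => rfl)

instance : Linear ℂ (Karoubi D) where
  smul_comp _ _ _ r f g := by ext; simp [summand_smul_f]
  comp_smul _ _ _ f r g := by ext; simp [summand_smul_f]
end Lin
end Envelope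
/-! ### Bosons, their centralizers and condensation -/

section Centralizer
variable {C : Type u} [Category.{v} C] [MonoidalCategory C] [BraidedCategory C]

/-- The objects `X` with `c_{b,X} c_{X,b} = id`. -/
def centralizer (b : C) : ObjectProperty C := fun X => (β_ X b).hom ≫ (β_ b X).hom = 𝟙 (X ⊗ b)

lemma monodromy_tensor (X Y b : C) : (β_ (X ⊗ Y) b).hom ≫ (β_ b (X ⊗ Y)).hom =
    𝟙 _ ⊗≫ X ◁ (β_ Y b).hom ⊗≫ ((β_ X b).hom ≫ (β_ b X).hom) ▷ Y ⊗≫ X ◁ (β_ b Y).hom ⊗≫ 𝟙 _ := by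
  rw [BraidedCategory.braiding_tensor_left_hom, BraidedCategory.braiding_tensor_right_hom]
  monoidal

lemma monodromy_tensor_of (X Y b : C) (hX : centralizer b X) :
   (β_ (X ⊗ Y) b).hom ≫ (β_ b (X ⊗ Y)).hom =
    (α_ _ _ _).hom ≫ X ◁ ((β_ Y b).hom ≫ (β_ b Y).hom) ≫ (α_ _ _ _).inv := by
  rw [monodromy_tensor, hX]
  monoidal

instance (b : C) : (centralizer b).IsMonoidal where
  prop_unit := by
    simp [centralizer, braiding_tensorUnit_left, braiding_tensorUnit_right]
  prop_tensor X Y hX hY := by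
    rw [centralizer, monodromy_tensor_of _ _ _ hX, hY]
    simp

lemma centralizer_rightDual [RightRigidCategory C] (b X : C) (hX : centralizer b X) :
    centralizer b Xᘁ := by
  set m : Xᘁ ⊗ b ⟶ Xᘁ ⊗ b := (β_ Xᘁ b).hom ≫ (β_ b Xᘁ).hom with hm
  have key : η_ X Xᘁ ▷ b ≫ (α_ _ _ _).hom ≫ X ◁ m = η_ X Xᘁ ▷ b ≫ (α_ _ _ _).hom := by
    have h1 := monodromy_tensor_of X Xᘁ b hX
    have h2 : η_ X Xᘁ ▷ b ≫ (β_ (X ⊗ Xᘁ) b).hom ≫ (β_ b (X ⊗ Xᘁ)).hom = η_ X Xᘁ ▷ b := by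
      rw [BraidedCategory.braiding_naturality_left_assoc, BraidedCategory.braiding_naturality_right]
      simp [braiding_tensorUnit_left, braiding_tensorUnit_right]
    rw [h1] at h2
    rw [← cancel_mono (α_ _ _ _).inv]
    simpa [hm] using h2
  have h3 : 𝟙 (Xᘁ ⊗ b) ⊗≫ Xᘁ ◁ (η_ X Xᘁ ▷ b ≫ (α_ _ _ _).hom ≫ X ◁ m) ⊗≫ ε_ X Xᘁ ▷ (Xᘁ ⊗ b) ⊗≫ 𝟙 (Xᘁ ⊗ b) = m := by
    calc
      _ = 𝟙 (Xᘁ ⊗ b) ⊗≫ Xᘁ ◁ η_ X Xᘁ ▷ b ⊗≫ ((Xᘁ ⊗ X) ◁ m ≫ ε_ X Xᘁ ▷ (Xᘁ ⊗ b)) ⊗≫ 𝟙 (Xᘁ ⊗ b) := by monoidal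
      _ = 𝟙 (Xᘁ ⊗ b) ⊗≫ (Xᘁ ◁ η_ X Xᘁ ≫ (α_ _ _ _).inv ≫ ε_ X Xᘁ ▷ Xᘁ) ▷ b ⊗≫ m := by
        rw [whisker_exchange]; monoidal
      _ = m := by rw [ExactPairing.coevaluation_evaluation]; monoidal
  have h4 : 𝟙 (Xᘁ ⊗ b) ⊗≫ Xᘁ ◁ (η_ X Xᘁ ▷ b ≫ (α_ _ _ _).hom) ⊗≫ ε_ X Xᘁ ▷ (Xᘁ ⊗ b) ⊗≫ 𝟙 (Xᘁ ⊗ b) = 𝟙 _ := by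
    calc
      _ = 𝟙 (Xᘁ ⊗ b) ⊗≫ (Xᘁ ◁ η_ X Xᘁ ≫ (α_ _ _ _).inv ≫ ε_ X Xᘁ ▷ Xᘁ) ▷ b ⊗≫ 𝟙 (Xᘁ ⊗ b) := by
        monoidal
      _ = _ := by rw [ExactPairing.coevaluation_evaluation]; monoidal
  change m = 𝟙 _
  rw [← h3, key, h4]

/-- The centralizer of the subcategory generated by `b`, as a full subcategory.  (If `b ⊗ b ≅ 𝟙`,
that subcategory consists of the sums of copies of `𝟙` and `b`, and an object centralizes it if
and only if it centralizes `b`.) -/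
abbrev Centralizer (b : C) := (centralizer b).FullSubcategory

instance [Preadditive C] [MonoidalPreadditive C] [HasFiniteBiproducts C] (b : C) :
    HasFiniteBiproducts (Centralizer b) where
  out n :=
    { has_biproduct := fun f => by
        have hm : centralizer b (⨁ fun i => (f i).obj) := by
          have h : 𝟙 ((⨁ fun i => (f i).obj) ⊗ b) =
              ∑ i, (biproduct.π _ i ▷ b ≫ biproduct.ι (fun i => (f i).obj) i ▷ b) := by
            simp only [← comp_whiskerRight, ← sum_whiskerRight, biproduct.total, id_whiskerRight]
          rw [centralizer, ← Category.id_comp ((β_ _ b).hom ≫ _), h, Preadditive.sum_comp]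
          refine Finset.sum_congr rfl fun i _ => ?_
          have hi := (f i).property
          rw [centralizer] at hi
          rw [Category.assoc, BraidedCategory.braiding_naturality_left_assoc,
            BraidedCategory.braiding_naturality_right, ← Category.assoc (β_ _ b).hom, hi,
            Category.id_comp]
        let c : Bicone f := Bicone.mk ⟨⨁ fun i => (f i).obj, hm⟩
          (fun i => ObjectProperty.homMk (biproduct.π _ i))
          (fun i => ObjectProperty.homMk (biproduct.ι (fun i => (f i).obj) i))
          (fun i j => by
            ext
            rcases eq_or_ne i j with rfl | hij
            · simp
            · simp [hij, biproduct.ι_π_ne _ hij])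
        refine hasBiproduct_of_total c ?_
        apply ObjectProperty.hom_ext
        have hs {P Q : Centralizer b} (g : Fin n → (P ⟶ Q)) :
            (∑ i, g i).hom = ∑ i, (g i).hom :=
          map_sum ((centralizer b).ι.mapAddHom (X := P) (Y := Q)) g _
        rw [hs]
        exact biproduct.total }

variable [RightRigidCategory C] (b : C)

instance (X : Centralizer b) : HasRightDual X where
  rightDual := ⟨X.objᘁ, centralizer_rightDual b _ X.property⟩
  exact :=
    { coevaluation' := ObjectProperty.homMk (η_ X.obj X.objᘁ)
      evaluation' := ObjectProperty.homMk (ε_ X.obj X.objᘁ)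
      coevaluation_evaluation' := by
        ext; exact ExactPairing.coevaluation_evaluation _ _
      evaluation_coevaluation' := by
        ext; exact ExactPairing.evaluation_coevaluation _ _ }

instance : RightRigidCategory (Centralizer b) where

instance [Ribbon C] : Ribbon (Centralizer b) where
  twist X := (centralizer b).isoMk (Ribbon.twist X.obj)
  twist_naturality f := by ext; exact Ribbon.twist_naturality _
  twist_tensor X Y := by ext; exact Ribbon.twist_tensor _ _
  twist_dual X := by ext; exact Ribbon.twist_dual _

end Centralizer

section
variable {C : Type u} [Category.{v} C] [MonoidalCategory C] {X X' Y Y' Z W V : C}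

lemma whiskerRight_tensorHom_comp (f : X ⟶ Y) (g : Y ⟶ Z) (h : X' ⟶ W) (k : Z ⊗ W ⟶ V) :
    f ▷ X' ≫ (g ⊗ₘ h) ≫ k = ((f ≫ g) ⊗ₘ h) ≫ k := by
  rw [← tensorHom_id, tensorHom_comp_tensorHom_assoc, Category.id_comp]

lemma whiskerLeft_tensorHom_comp (f : X ⟶ Y) (g : Y ⟶ Z) (h : X' ⟶ W) (k : W ⊗ Z ⟶ V) :
    X' ◁ f ≫ (h ⊗ₘ g) ≫ k = (h ⊗ₘ (f ≫ g)) ≫ k := by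
  rw [← id_tensorHom, tensorHom_comp_tensorHom_assoc, Category.id_comp]

lemma tensor_split_left (f : X ⟶ Y) (g : Y ⟶ Z) (h : X' ⟶ W) (k : Z ⊗ W ⟶ V) :
    ((f ≫ g) ⊗ₘ h) ≫ k = (f ⊗ₘ h) ≫ g ▷ W ≫ k := by
  rw [← tensorHom_id, tensorHom_comp_tensorHom_assoc, Category.comp_id]

lemma tensor_split_right (f : X ⟶ Y) (g : Y ⟶ Z) (h : X' ⟶ W) (k : W ⊗ Z ⟶ V) :
    (h ⊗ₘ (f ≫ g)) ≫ k = (h ⊗ₘ f) ≫ W ◁ g ≫ k := by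
  rw [← id_tensorHom, tensorHom_comp_tensorHom_assoc, Category.comp_id]
end

section Boson
variable (C : Type u) [Category.{v} C] [MonoidalCategory C] [BraidedCategory C]
   [RightRigidCategory C] [Ribbon C]

/-- A boson `b`: an object with `b ⊗ b ≅ 𝟙` and `c_{b,b} = id` which, together with the unit,
generates a copy of `Rep(ℤ/2)` in `C` as a ribbon category, so that it is not the unit and has
trivial twist (equivalently, dimension `1`).  The isomorphism `b ⊗ b ≅ 𝟙` is unique up to a
scalar. -/
structure Boson where
  obj : C
  sq : obj ⊗ obj ≅ 𝟙_ C
  braiding_self : (β_ obj obj).hom = 𝟙 (obj ⊗ obj)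
  twist_eq : (Ribbon.twist obj).hom = 𝟙 obj
  nontrivial : IsEmpty (obj ≅ 𝟙_ C)

variable {C}
lemma Boson.sq_assoc (b : Boson C) :
    b.sq.hom ▷ b.obj ≫ (λ_ b.obj).hom =
      (α_ b.obj b.obj b.obj).hom ≫ b.obj ◁ b.sq.hom ≫ (ρ_ b.obj).hom := by
  have h1 := BraidedCategory.hexagon_forward b.obj b.obj b.obj
  rw [b.braiding_self] at h1
  have h2 : (β_ b.obj (b.obj ⊗ b.obj)).hom = (α_ b.obj b.obj b.obj).inv := by
    rw [← cancel_epi (α_ b.obj b.obj b.obj).hom, ← cancel_mono (α_ b.obj b.obj b.obj).hom]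
    simpa using h1
  have h3 := BraidedCategory.braiding_naturality_right b.obj b.sq.hom
  rw [h2, braiding_tensorUnit_right] at h3
  rw [← cancel_epi (α_ b.obj b.obj b.obj).inv, ← cancel_mono (λ_ b.obj).inv]
  simp [← h3]

variable [Preadditive C] [MonoidalPreadditive C] [HasBinaryBiproducts C]

noncomputable section

/-- The product of `A = 𝟙 ⊞ b`, given on the four summands of `A ⊗ A` by the unit isomorphisms
and by `b ⊗ b ≅ 𝟙`. -/
def algMul (b : Boson C) : (𝟙_ C ⊞ b.obj) ⊗ (𝟙_ C ⊞ b.obj) ⟶ 𝟙_ C ⊞ b.obj :=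
  biprod.lift
    ((biprod.fst ⊗ₘ biprod.fst) ≫ (λ_ (𝟙_ C)).hom + (biprod.snd ⊗ₘ biprod.snd) ≫ b.sq.hom)
    ((biprod.fst ⊗ₘ biprod.snd) ≫ (λ_ b.obj).hom + (biprod.snd ⊗ₘ biprod.fst) ≫ (ρ_ b.obj).hom)

variable (b : Boson C)

lemma algMul_fst : algMul b ≫ biprod.fst =
    (biprod.fst ⊗ₘ biprod.fst) ≫ (λ_ (𝟙_ C)).hom + (biprod.snd ⊗ₘ biprod.snd) ≫ b.sq.hom := by
  simp [algMul]

lemma algMul_snd : algMul b ≫ biprod.snd =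
    (biprod.fst ⊗ₘ biprod.snd) ≫ (λ_ b.obj).hom +
      (biprod.snd ⊗ₘ biprod.fst) ≫ (ρ_ b.obj).hom := by
  simp [algMul]

lemma algMul_one_mul : biprod.inl ▷ (𝟙_ C ⊞ b.obj) ≫ algMul b = (λ_ (𝟙_ C ⊞ b.obj)).hom := by
  apply biprod.hom_ext
  · rw [Category.assoc, algMul_fst, Preadditive.comp_add, whiskerRight_tensorHom_comp,
      whiskerRight_tensorHom_comp]
    simp
  · rw [Category.assoc, algMul_snd, Preadditive.comp_add, whiskerRight_tensorHom_comp,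
      whiskerRight_tensorHom_comp]
    simp

lemma algMul_mul_one : (𝟙_ C ⊞ b.obj) ◁ biprod.inl ≫ algMul b = (ρ_ (𝟙_ C ⊞ b.obj)).hom := by
  apply biprod.hom_ext
  · rw [Category.assoc, algMul_fst, Preadditive.comp_add, whiskerLeft_tensorHom_comp,
      whiskerLeft_tensorHom_comp]
    simp [unitors_equal]
  · rw [Category.assoc, algMul_snd, Preadditive.comp_add, whiskerLeft_tensorHom_comp,
      whiskerLeft_tensorHom_comp]
    simp

lemma algMul_assoc : algMul b ▷ (𝟙_ C ⊞ b.obj) ≫ algMul b =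
    (α_ _ _ _).hom ≫ (𝟙_ C ⊞ b.obj) ◁ algMul b ≫ algMul b := by
  apply biprod.hom_ext
  · simp only [Category.assoc, algMul_fst, Preadditive.comp_add, whiskerRight_tensorHom_comp,
      whiskerLeft_tensorHom_comp, algMul_snd, MonoidalPreadditive.add_tensor, MonoidalPreadditive.tensor_add, Preadditive.add_comp,
      tensor_split_left, tensor_split_right]
    simp only [← associator_naturality_assoc]
    have e1 : (λ_ (𝟙_ C)).hom ▷ 𝟙_ C ≫ (λ_ _).hom =
      (α_ _ _ _).hom ≫ 𝟙_ C ◁ (λ_ (𝟙_ C)).hom ≫ (λ_ _).hom := by monoidal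
    have e2 : b.sq.hom ▷ 𝟙_ C ≫ (λ_ _).hom =
      (α_ _ _ _).hom ≫ b.obj ◁ (ρ_ b.obj).hom ≫ b.sq.hom := by monoidal
    have e3 : (λ_ b.obj).hom ▷ b.obj ≫ b.sq.hom =
      (α_ _ _ _).hom ≫ 𝟙_ C ◁ b.sq.hom ≫ (λ_ _).hom := by monoidal
    have e4 : (ρ_ b.obj).hom ▷ b.obj ≫ b.sq.hom =
      (α_ _ _ _).hom ≫ b.obj ◁ (λ_ b.obj).hom ≫ b.sq.hom := by monoidal
    rw [e1, e2, e3, e4]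
    abel
  · simp only [Category.assoc, algMul_fst, Preadditive.comp_add, whiskerRight_tensorHom_comp,
      whiskerLeft_tensorHom_comp, algMul_snd, MonoidalPreadditive.add_tensor, MonoidalPreadditive.tensor_add, Preadditive.add_comp,
      tensor_split_left, tensor_split_right]
    simp only [← associator_naturality_assoc]
    have e1 : (λ_ (𝟙_ C)).hom ▷ b.obj ≫ (λ_ _).hom =
      (α_ _ _ _).hom ≫ 𝟙_ C ◁ (λ_ b.obj).hom ≫ (λ_ _).hom := by monoidal
    have e3 : (λ_ b.obj).hom ▷ 𝟙_ C ≫ (ρ_ _).hom =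
      (α_ _ _ _).hom ≫ 𝟙_ C ◁ (ρ_ b.obj).hom ≫ (λ_ _).hom := by monoidal
    have e4 : (ρ_ b.obj).hom ▷ 𝟙_ C ≫ (ρ_ _).hom =
      (α_ _ _ _).hom ≫ b.obj ◁ (λ_ (𝟙_ C)).hom ≫ (ρ_ _).hom := by monoidal
    rw [e1, b.sq_assoc, e3, e4]
    abel

lemma algMul_comm : (β_ _ _).hom ≫ algMul b = algMul b := by
  apply biprod.hom_ext
  · simp only [Category.assoc, algMul_fst, Preadditive.comp_add]
    rw [← BraidedCategory.braiding_naturality_assoc, ← BraidedCategory.braiding_naturality_assoc,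
      b.braiding_self]
    simp [braiding_tensorUnit_right, unitors_equal, unitors_inv_equal]
  · simp only [Category.assoc, algMul_snd, Preadditive.comp_add]
    rw [← BraidedCategory.braiding_naturality_assoc, ← BraidedCategory.braiding_naturality_assoc]
    simp [braiding_tensorUnit_right, braiding_tensorUnit_left, add_comm]

lemma unit_add_tensor_ext {b X Z : C} {f g : (𝟙_ C ⊞ b) ⊗ X ⟶ Z}
    (h₀ : biprod.inl ▷ X ≫ f = biprod.inl ▷ X ≫ g) (h₁ : biprod.inr ▷ X ≫ f = biprod.inr ▷ X ≫ g) :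
    f = g := by
  have h : 𝟙 ((𝟙_ C ⊞ b) ⊗ X) = biprod.fst ▷ X ≫ biprod.inl ▷ X + biprod.snd ▷ X ≫ biprod.inr ▷ X := by
    rw [← comp_whiskerRight, ← comp_whiskerRight, ← MonoidalPreadditive.add_whiskerRight,
      biprod.total, id_whiskerRight]
  rw [← Category.id_comp f, ← Category.id_comp g, h]
  simp [h₀, h₁]

lemma unit_add_monodromy {b X : C} (hX : centralizer b X) :
    (β_ (𝟙_ C ⊞ b) X).hom ≫ (β_ X (𝟙_ C ⊞ b)).hom = 𝟙 _ := by
  apply unit_add_tensor_ext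
  · rw [BraidedCategory.braiding_naturality_left_assoc, BraidedCategory.braiding_naturality_right]
    simp [braiding_tensorUnit_left, braiding_tensorUnit_right]
  · rw [BraidedCategory.braiding_naturality_left_assoc, BraidedCategory.braiding_naturality_right]
    have : (β_ b X).hom ≫ (β_ X b).hom = 𝟙 _ := by
      rw [← cancel_epi (β_ X b).hom, ← Category.assoc, hX]; simp
    rw [← Category.assoc, this]; simp

/-- The algebra `A = 𝟙 ⊞ b`, as an object of the centralizer of `b`. -/
def condAlg : Centralizer b.obj := ⟨𝟙_ C ⊞ b.obj, by
  have hb : centralizer b.obj b.obj := by simp [centralizer, b.braiding_self]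
  exact unit_add_monodromy hb⟩

instance : MonObj (condAlg b) where
  one := ObjectProperty.homMk biprod.inl
  mul := ObjectProperty.homMk (algMul b)
  one_mul := by ext; exact algMul_one_mul b
  mul_one := by ext; exact algMul_mul_one b
  mul_assoc := by ext; exact algMul_assoc b

instance : IsCommMonObj (condAlg b) where
  mul_comm := by ext; exact algMul_comm b

instance : Transparent (condAlg b) where
  braiding_braiding X := by ext; exact unit_add_monodromy X.property

lemma twist_unit : (Ribbon.twist (𝟙_ C)).hom = 𝟙 _ := by
  have h := Ribbon.twist_tensor (𝟙_ C) (𝟙_ C)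
  have h2 := Ribbon.twist_naturality (λ_ (𝟙_ C)).hom
  rw [h, braiding_tensorUnit_right, Category.assoc, MonoidalCategory.tensorHom_def,
    unitors_equal, unitors_inv_equal] at h2
  simp only [Iso.hom_inv_id, Category.id_comp, Category.comp_id, Category.assoc] at h2
  rw [← unitors_equal, leftUnitor_naturality, unitors_equal, rightUnitor_naturality_assoc,
    cancel_epi] at h2
  rw [← cancel_epi (Ribbon.twist (𝟙_ C)).hom, ← h2, Category.comp_id]

instance : TwistTrivial (condAlg b) where
  twist_eq := by
    ext
    change (Ribbon.twist (𝟙_ C ⊞ b.obj)).hom = 𝟙 _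
    apply biprod.hom_ext'
    · rw [Ribbon.twist_naturality, twist_unit]; simp
    · rw [Ribbon.twist_naturality, b.twist_eq]; simp

/-- The category `C_A^0` of local modules over `A = 𝟙 ⊞ b`, that is, the `ℤ/2`-de-equivariantization
of the centralizer of `b`: the idempotent completion of the category of free modules `A ⊗ X`,
with `X` in the centralizer.  An object is a direct summand of some `A ⊗ X` (given by an `A`-linear
idempotent), and a morphism is an `A`-linear map of such summands.  As `A` is separable, every
`A`-module `M` is a direct summand of the free module `A ⊗ M`, and an `A`-module is local if and
only if it lies in the centralizer of `b`. -/
abbrev Condensate : Type _ := Idempotents.Karoubi (FreeMod (condAlg b))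

/-- The condensation functor `X ↦ A ⊗ X` from the centralizer of `b` to `C_A^0`. -/
def condense : Centralizer b.obj ⥤ Condensate b :=
  FreeMod.free (condAlg b) ⋙ Idempotents.toKaroubi _

end

end Boson

section ScalarUnit
variable {C : Type u} [Category.{v} C] [MonoidalCategory C] [BraidedCategory C]
  [RightRigidCategory C] [Ribbon C] (b : Boson C)

lemma Boson.whiskerLeft_injective {X Y : C} (f g : X ⟶ Y) (h : b.obj ◁ f = b.obj ◁ g) :
    f = g := by
  have h2 : (b.obj ⊗ b.obj) ◁ f = (b.obj ⊗ b.obj) ◁ g := by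
    rw [tensor_whiskerLeft, tensor_whiskerLeft, h]
  have h3 : 𝟙_ C ◁ f = 𝟙_ C ◁ g := by
    rw [← cancel_epi (b.sq.hom ▷ X), ← whisker_exchange, ← whisker_exchange, h2]
  simpa using h3

variable [Abelian C] [Linear ℂ C] [MonoidalPreadditive C] [MonoidalLinear ℂ C] [IsFusion C]

lemma Boson.hom_eq_zero (f : 𝟙_ C ⟶ b.obj) : f = 0 := by
  by_contra hf
  have := IsFusion.simple_unit (C := C)
  have : Mono f := mono_of_nonzero_from_simple hf
  let g : b.obj ⟶ 𝟙_ C := (ρ_ b.obj).inv ≫ b.obj ◁ f ≫ b.sq.hom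
  have hg : g ≠ 0 := by
    intro h
    apply hf
    apply b.whiskerLeft_injective
    have h' : (ρ_ b.obj).inv ≫ b.obj ◁ f ≫ b.sq.hom = 0 := h
    rw [← cancel_epi (ρ_ b.obj).inv, ← cancel_mono b.sq.hom, Category.assoc, h']
    simp
  obtain ⟨z, hz⟩ : ∃ z : ℂ, z • 𝟙 b.obj = g ≫ f := by
    obtain ⟨z, hz⟩ := (HasScalarUnit.bijective (C := C)).2
      (b.sq.inv ≫ b.obj ◁ (g ≫ f) ≫ b.sq.hom)
    refine ⟨z, b.whiskerLeft_injective _ _ ?_⟩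
    rw [← cancel_epi b.sq.inv, ← cancel_mono b.sq.hom, Category.assoc, Category.assoc, ← hz]
    simp
  have hz0 : z ≠ 0 := by
    rintro rfl
    rw [zero_smul] at hz
    apply hg
    rw [← cancel_mono f, ← hz, zero_comp]
  have : IsSplitEpi f := ⟨⟨z⁻¹ • g, by rw [Linear.smul_comp, ← hz, smul_smul, inv_mul_cancel₀ hz0, one_smul]⟩⟩
  have : IsIso f := isIso_of_mono_of_isSplitEpi f
  exact b.nontrivial.false (asIso f).symm

instance : HasScalarUnit (Condensate b) where
  bijective := by
    have key (z : ℂ) : (z • 𝟙 (𝟙_ (Condensate b))).f.val.hom =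
        z • ((λ_ (𝟙_ C)).inv ≫ biprod.inl ▷ 𝟙_ C) := rfl
    constructor
    · intro z w h
      apply (HasScalarUnit.bijective (C := C)).1
      have h' : z • ((λ_ (𝟙_ C)).inv ≫ biprod.inl (Y := b.obj) ▷ 𝟙_ C) =
          w • ((λ_ (𝟙_ C)).inv ≫ biprod.inl ▷ 𝟙_ C) := by
        rw [← key, ← key]
        exact congr(($h).f.val.hom)
      have h2 := congr($h' ≫ biprod.fst ▷ 𝟙_ C ≫ (λ_ (𝟙_ C)).hom)
      simpa [← comp_whiskerRight_assoc] using h2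
    · intro f
      let v : 𝟙_ C ⟶ (𝟙_ C ⊞ b.obj) ⊗ 𝟙_ C := f.f.val.hom
      obtain ⟨z, hz⟩ := (HasScalarUnit.bijective (C := C)).2
        (v ≫ biprod.fst ▷ 𝟙_ C ≫ (λ_ (𝟙_ C)).hom)
      refine ⟨z, ?_⟩
      apply Idempotents.Karoubi.hom_ext
      apply FreeMod.hom_ext
      apply ObjectProperty.hom_ext
      change z • ((λ_ (𝟙_ C)).inv ≫ biprod.inl ▷ 𝟙_ C) = v
      have h0 : v ≫ biprod.snd ▷ 𝟙_ C = 0 := by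
        rw [← cancel_mono (ρ_ b.obj).hom, Category.assoc]
        rw [b.hom_eq_zero (v ≫ _), zero_comp]
      have h1 : v ≫ biprod.fst ▷ 𝟙_ C = z • (λ_ (𝟙_ C)).inv := by
        rw [← cancel_mono (λ_ (𝟙_ C)).hom, Category.assoc, ← hz]
        simp
      have h : 𝟙 ((𝟙_ C ⊞ b.obj) ⊗ 𝟙_ C) =
          biprod.fst ▷ _ ≫ biprod.inl ▷ _ + biprod.snd ▷ _ ≫ biprod.inr ▷ _ := by
        rw [← comp_whiskerRight, ← comp_whiskerRight, ← MonoidalPreadditive.add_whiskerRight,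
          biprod.total, id_whiskerRight]
      rw [← Category.comp_id v, h, Preadditive.comp_add, reassoc_of% h0, reassoc_of% h1]
      simp

instance : HasBinaryBiproducts (Condensate b) :=
  hasBinaryBiproducts_of_finite_biproducts _

end ScalarUnit

end Condensation

namespace Condensation

section Trace

variable {D : Type u} [Category.{v} D] [MonoidalCategory D] [BraidedCategory D]
  [RightRigidCategory D] [Ribbon D]

/-- The quantum trace is cyclic. -/
lemma qTrace_comp_comm {X Y : D} (f : X ⟶ Y) (g : Y ⟶ X) : qTrace (f ≫ g) = qTrace (g ≫ f) := by
  calc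
    _ = η_ X Xᘁ ≫ (f ≫ (Ribbon.twist Y).hom) ▷ Xᘁ ≫ (β_ Y Xᘁ).hom ≫ Xᘁ ◁ g ≫ ε_ X Xᘁ := by
      rw [qTrace, Category.assoc, Ribbon.twist_naturality, ← Category.assoc f, comp_whiskerRight,
        Category.assoc, BraidedCategory.braiding_naturality_left_assoc]
    _ = (η_ X Xᘁ ≫ X ◁ gᘁ) ≫ (f ≫ (Ribbon.twist Y).hom) ▷ Yᘁ ≫ (β_ Y Yᘁ).hom ≫ ε_ Y Yᘁ := by
      rw [← rightAdjointMate_comp_evaluation,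
        ← BraidedCategory.braiding_naturality_right_assoc, Category.assoc,
        whisker_exchange_assoc]
    _ = _ := by
      rw [coevaluation_comp_rightAdjointMate, qTrace, Category.assoc, Category.assoc,
        ← comp_whiskerRight_assoc]

/-- The double braiding of `U` and `Y`. -/
def monodromy (U Y : D) : U ⊗ Y ⟶ U ⊗ Y := (β_ U Y).hom ≫ (β_ Y U).hom

lemma monodromy_naturality_right (U : D) {Y Z : D} (f : Y ⟶ Z) :
    U ◁ f ≫ monodromy U Z = monodromy U Y ≫ U ◁ f := by
  simp [monodromy]

lemma monodromy_naturality_left {U V : D} (f : U ⟶ V) (Y : D) :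
    f ▷ Y ≫ monodromy V Y = monodromy U Y ≫ f ▷ Y := by
  simp [monodromy]

lemma qTrace_monodromy_retract (U : D) {Y Z : D} (i : Z ⟶ Y) (p : Y ⟶ Z) (h : i ≫ p = 𝟙 Z) :
    qTrace (monodromy U Y ≫ U ◁ (p ≫ i)) = qTrace (monodromy U Z) := by
  rw [MonoidalCategory.whiskerLeft_comp, ← Category.assoc, qTrace_comp_comm,
    ← Category.assoc, monodromy_naturality_right, Category.assoc,
    ← MonoidalCategory.whiskerLeft_comp, h, MonoidalCategory.whiskerLeft_id, Category.comp_id]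

lemma qTrace_monodromy_congr_right (U : D) {Y Z : D} (e : Y ≅ Z) :
    qTrace (monodromy U Y) = qTrace (monodromy U Z) := by
  rw [← qTrace_monodromy_retract U e.inv e.hom e.inv_hom_id, e.hom_inv_id,
    MonoidalCategory.whiskerLeft_id, Category.comp_id]

lemma qTrace_monodromy_congr_left {U V : D} (e : U ≅ V) (Y : D) :
    qTrace (monodromy U Y) = qTrace (monodromy V Y) := by
  calc
    _ = qTrace (e.hom ▷ Y ≫ monodromy V Y ≫ e.inv ▷ Y) := by
      rw [← Category.assoc, monodromy_naturality_left, Category.assoc, ← comp_whiskerRight,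
        e.hom_inv_id, id_whiskerRight, Category.comp_id]
    _ = _ := by
      rw [qTrace_comp_comm, Category.assoc, ← comp_whiskerRight, e.inv_hom_id, id_whiskerRight,
        Category.comp_id]

/-- Isomorphic objects have isomorphic duals. -/
def isoRightDual {X Y : D} (e : X ≅ Y) : Xᘁ ≅ Yᘁ where
  hom := e.invᘁ
  inv := e.homᘁ
  hom_inv_id := by rw [← comp_rightAdjointMate, e.hom_inv_id, rightAdjointMate_id]
  inv_hom_id := by rw [← comp_rightAdjointMate, e.inv_hom_id, rightAdjointMate_id]

variable [Preadditive D] [Linear ℂ D] [HasScalarUnit D]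

lemma sTilde_eq (X Y : D) : sTilde X Y = scalar (qTrace (monodromy Xᘁ Y)) := rfl

lemma sTilde_congr {X X' Y Y' : D} (e : X ≅ X') (e' : Y ≅ Y') : sTilde X Y = sTilde X' Y' := by
  rw [sTilde_eq, sTilde_eq, qTrace_monodromy_congr_left (isoRightDual e),
    qTrace_monodromy_congr_right _ e']

lemma scalar_eq_of_smul {f : 𝟙_ D ⟶ 𝟙_ D} {z : ℂ} (h : z • 𝟙 (𝟙_ D) = f) : scalar f = z :=
  (HasScalarUnit.bijective (C := D)).1 ((scalar_smul f).trans h.symm)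

lemma scalar_add (f g : 𝟙_ D ⟶ 𝟙_ D) : scalar (f + g) = scalar f + scalar g :=
  scalar_eq_of_smul (by rw [add_smul, scalar_smul, scalar_smul])

variable [MonoidalPreadditive D]

lemma qTrace_add {X : D} (f g : X ⟶ X) : qTrace (f + g) = qTrace f + qTrace g := by
  simp [qTrace, MonoidalPreadditive.add_whiskerRight]

lemma sTilde_biprod (X Y Z : D) [HasBinaryBiproduct Y Z] :
    sTilde X (Y ⊞ Z) = sTilde X Y + sTilde X Z := by
  rw [sTilde_eq, sTilde_eq, sTilde_eq, ← scalar_add,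
    ← qTrace_monodromy_retract Xᘁ (biprod.inl : Y ⟶ Y ⊞ Z) biprod.fst biprod.inl_fst,
    ← qTrace_monodromy_retract Xᘁ (biprod.inr : Z ⟶ Y ⊞ Z) biprod.snd biprod.inr_snd,
    ← qTrace_add, ← Preadditive.comp_add, ← MonoidalPreadditive.whiskerLeft_add, biprod.total,
    MonoidalCategory.whiskerLeft_id, Category.comp_id]

end Trace

section Instances

open MonObj

instance {B : Type u} [Category.{v} B] [MonoidalCategory B] [BraidedCategory B] (A : B)
    [MonObj A] [IsCommMonObj A] [Preadditive B] [MonoidalPreadditive B] :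
    MonoidalPreadditive (FreeMod A) where
  whiskerLeft_zero {X Y Z} := by
    apply FreeMod.hom_ext
    change X.gen ◁ (0 : Y.gen ⟶ A ⊗ Z.gen) ≫ _ = (0 : X.gen ⊗ Y.gen ⟶ A ⊗ (X.gen ⊗ Z.gen))
    simp
  zero_whiskerRight {X Y Z} := by
    apply FreeMod.hom_ext
    change (0 : Y.gen ⟶ A ⊗ Z.gen) ▷ X.gen ≫ _ = (0 : Y.gen ⊗ X.gen ⟶ A ⊗ (Z.gen ⊗ X.gen))
    simp
  whiskerLeft_add {X Y Z} f g := by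
    apply FreeMod.hom_ext
    change X.gen ◁ (f.val + g.val) ≫ _ = X.gen ◁ f.val ≫ _ + X.gen ◁ g.val ≫ _
    simp
  add_whiskerRight {X Y Z} f g := by
    apply FreeMod.hom_ext
    change (f.val + g.val) ▷ X.gen ≫ _ = f.val ▷ X.gen ≫ _ + g.val ▷ X.gen ≫ _
    simp

instance {D : Type u} [Category.{v} D] [MonoidalCategory D] [Preadditive D]
    [MonoidalPreadditive D] : MonoidalPreadditive (Idempotents.Karoubi D) where
  whiskerLeft_zero {P Q R} := by ext; exact MonoidalPreadditive.tensor_zero _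
  zero_whiskerRight {P Q R} := by ext; exact MonoidalPreadditive.zero_tensor _
  whiskerLeft_add {P Q R} f g := by ext; exact MonoidalPreadditive.tensor_add _ _ _
  add_whiskerRight {P Q R} f g := by ext; exact MonoidalPreadditive.add_tensor _ _ _

end Instances

section Compatibility

lemma FreeMod.monodromy_eq {B : Type u} [Category.{v} B] [MonoidalCategory B] [BraidedCategory B]
    {A : B} [MonObj A] [IsCommMonObj A] [Transparent A] (X Y : B) :
    monodromy (⟨X⟩ : FreeMod A) ⟨Y⟩ = freeMap A (monodromy X Y) :=
  (FreeMod.freeMap_comp _ _).symm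

lemma FreeMod.qTrace_freeMap {B : Type u} [Category.{v} B] [MonoidalCategory B]
    [BraidedCategory B] [RightRigidCategory B] [Ribbon B] {A : B} [MonObj A] [IsCommMonObj A]
    [Transparent A] [TwistTrivial A] {X : B} (f : X ⟶ X) :
    qTrace (X := (⟨X⟩ : FreeMod A)) (freeMap A f) = freeMap A (qTrace f) := by
  change freeMap A _ ≫ wR (freeMap A f ≫ freeMap A _) ⟨Xᘁ⟩ ≫ freeMap A _ ≫ freeMap A _ = _
  simp only [← freeMap_comp, wR_free]
  rfl

/-- The quantum trace in an idempotent completion, computed in the category itself. -/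
lemma qTrace_f {D : Type u} [Category.{v} D] [MonoidalCategory D] [BraidedCategory D]
    [RightRigidCategory D] [Ribbon D] {P : Idempotents.Karoubi D} (f : P ⟶ P) :
    (qTrace f).f = qTrace f.f := by
  change (η_ P.X P.Xᘁ ≫ P.p ▷ _) ≫ ((f.f ≫ P.p ≫ (Ribbon.twist P.X).hom) ⊗ₘ rightAdjointMate P.p) ≫
    ((P.p ⊗ₘ rightAdjointMate P.p) ≫ (β_ P.X P.Xᘁ).hom) ≫ P.Xᘁ ◁ P.p ≫ ε_ P.X P.Xᘁ = _
  have hq : rightAdjointMate P.p ≫ rightAdjointMate P.p = rightAdjointMate P.p := by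
    rw [← comp_rightAdjointMate, P.idem]
  rw [← coev_absorb _ _ P.idem]
  simp only [Category.assoc, tensorHom_comp_tensorHom_assoc, hq]
  rw [← BraidedCategory.braiding_naturality_left_assoc, ← tensorHom_id,
    tensorHom_comp_tensorHom_assoc, Category.comp_id, tensorHom_def', Category.assoc,
    coevaluation_comp_rightAdjointMate_assoc, ← comp_whiskerRight_assoc]
  simp only [Category.assoc, ← Ribbon.twist_naturality, Idempotents.Karoubi.p_comp_assoc,
    Idempotents.Karoubi.comp_p_assoc, P.idem_assoc]
  rfl

lemma summand_monodromy_f {D : Type u} [Category.{v} D] [MonoidalCategory D] [BraidedCategory D]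
    (P Q : Idempotents.Karoubi D) : (monodromy P Q).f = (P.p ⊗ₘ Q.p) ≫ monodromy P.X Q.X := by
  rw [monodromy, summand_braiding, summand_braiding, comp_summandIso_f, summandIso_hom,
    summandMap_f, Category.assoc]
  rfl

variable {C : Type u} [Category.{v} C] [Abelian C] [Linear ℂ C] [MonoidalCategory C]
  [MonoidalPreadditive C] [MonoidalLinear ℂ C] [RigidCategory C] [IsFusion C]
  [BraidedCategory C] [Ribbon C] (b : Boson C)

lemma sTilde_condense (X Y : Centralizer b.obj) :
    sTilde ((condense b).obj X) ((condense b).obj Y) = sTilde X.obj Y.obj := by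
  apply scalar_eq_of_smul
  apply Idempotents.Karoubi.hom_ext
  have h : (monodromy (((condense b).obj X)ᘁ) ((condense b).obj Y)).f =
      FreeMod.freeMap (condAlg b) (monodromy Xᘁ Y) := by
    rw [summand_monodromy_f, ← FreeMod.monodromy_eq]
    change (rightAdjointMate (𝟙 (⟨X⟩ : FreeMod (condAlg b))) ⊗ₘ 𝟙 (⟨Y⟩ : FreeMod (condAlg b))) ≫ _ = _
    rw [rightAdjointMate_id, id_tensorHom_id]
    exact Category.id_comp _
  have h' : qTrace (monodromy Xᘁ Y) = sTilde X.obj Y.obj • 𝟙 (𝟙_ (Centralizer b.obj)) := by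
    ext
    exact (scalar_smul _).symm
  refine Eq.trans ?_ (qTrace_f (monodromy (((condense b).obj X)ᘁ) ((condense b).obj Y))).symm
  rw [h]
  refine Eq.trans ?_ (FreeMod.qTrace_freeMap _).symm
  rw [h']
  apply FreeMod.hom_ext
  change _ • ((λ_ _).inv ≫ _) = (_ • 𝟙 _) ≫ _
  rw [Linear.smul_comp]
  exact congrArg _ (Category.id_comp _).symm

end Compatibility

end Condensation

theorem theorem2p2 {C : Type u} [Category.{v} C] [Abelian C] [Linear ℂ C] [MonoidalCategory C]
    [MonoidalPreadditive C] [MonoidalLinear ℂ C] [RigidCategory C] [Condensation.IsFusion C]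
    [BraidedCategory C] [Condensation.Ribbon C]
    (b : Condensation.Boson C) (X Y : Condensation.Centralizer b.obj) :
    (∀ α β : Condensation.Condensate b, Simple α → Simple β →
      Nonempty ((Condensation.condense b).obj X ≅ α) →
      Nonempty ((Condensation.condense b).obj Y ≅ β) →
      Condensation.sTilde α β = Condensation.sTilde X.obj Y.obj) ∧
    (∀ α β₁ β₂ : Condensation.Condensate b, Simple α → Simple β₁ → Simple β₂ →
      Nonempty ((Condensation.condense b).obj X ≅ α) →
      Nonempty ((Condensation.condense b).obj Y ≅ β₁ ⊞ β₂) →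
      Condensation.sTilde α β₁ + Condensation.sTilde α β₂ =
        Condensation.sTilde X.obj Y.obj) := by
  open Condensation in
  refine ⟨?_, ?_⟩
  · rintro α β - - ⟨e⟩ ⟨e'⟩
    rw [← sTilde_condense, sTilde_congr e e']
  · rintro α β₁ β₂ - - - ⟨e⟩ ⟨e'⟩
    rw [← sTilde_condense, sTilde_congr e e', sTilde_biprod]
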